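/- Let $(M,g_M,J)$ be a Kähler manifold, that is, a smooth Riemannian manifold with a smooth almost complex structure $J$ such that $J^2=-\mathrm{id}$, $g_M(JX,JY)=g_M(X,Y)$ and $\nabla J=0$, where $\nabla$ is the Levi-Civita connection of $g_M$. Let $(N,g_N)$ be a Riemannian manifold and let $F:M\to N$ be a v-semi-slant submersion onto $N$. This means that $F$ is a surjective smooth submersion whose differential $F_*$ preserves the lengths of horizontal vectors (the vectors in $(\ker F_*)^\perp$), and that there is a smooth distribution $\mathcal D_1\subset(\ker F_*)^\perp$ with $J(\mathcal D_1)=\mathcal D_1$ such that, if $\mathcal D_2$ denotes the orthogonal complement of $\mathcal D_1$ in $(\ker F_*)^\perp$, the angle $\theta$ between $JX$ and the space $(\mathcal D_2)_p$ is the same for all $p\in M$ and all nonzero $X\in(\mathcal D_2)_p$. Denote by $\mathcal V$ and $\mathcal H$ the orthogonal projections of $TM$ onto $\ker F_*$ and $(\ker F_*)^\perp$. For $X\in\Gamma(\ker F_*)$ put $\phi X=\mathcal V(JX)$; for $Z\in\Gamma((\ker F_*)^\perp)$ put $BZ=\mathcal V(JZ)$ and $CZ=\mathcal H(JZ)$,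 so that $JZ=BZ+CZ$. For vector fields $U,W$ on $M$ put $$\mathcal A_UW=\mathcal H\nabla_{\mathcal HU}\mathcal VW+\mathcal V\nabla_{\mathcal HU}\mathcal HW .$$ A distribution $\mathcal D$ on $M$ is said to define a totally geodesic foliation if it is integrable, i.e. $[X,Y]\in\Gamma(\mathcal D)$ for all $X,Y\in\Gamma(\mathcal D)$, and its leaves are totally geodesic, i.e. their second fundamental form, the component of $\nabla_XY$ orthogonal to $\mathcal D$ for $X,Y\in\Gamma(\mathcal D)$, vanishes. Then the distribution $(\ker F_*)^\perp$ defines a totally geodesic foliation if and only if $$\phi(\mathcal V\nabla_XBY+\mathcal A_XCY)+B(\mathcal A_XBY+\mathcal H\nabla_XCY)=0\qquad\text{for all }X,Y\in\Gamma((\ker F_*)^\perp).$$ -/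

import Mathlib

open Bundle VectorField
open scoped Manifold ContDiff

noncomputable section

namespace SlantSubmersion

section LeviCivita

variable {E : Type*} [NormedAddCommGroup E] [NormedSpace ℝ E]
  {H : Type*} [TopologicalSpace H] {I : ModelWithCorners ℝ E H}
  {M : Type*} [TopologicalSpace M] [ChartedSpace H M]

theorem mdiffAt_inner [IsManifold I ∞ M] [RiemannianBundle (fun x : M ↦ TangentSpace I x)]
    [IsContMDiffRiemannianBundle I ∞ E (fun x : M ↦ TangentSpace I x)]
    {X Y : Π x : M, TangentSpace I x} {x : M}
    (hX : MDiffAt (T% X) x) (hY : MDiffAt (T% Y) x) :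
    MDiffAt (fun y ↦ inner ℝ (X y) (Y y)) x :=
  MDifferentiableAt.inner_bundle (E := fun x : M ↦ TangentSpace I x) hX hY

variable [FiniteDimensional ℝ E]

instance finiteDimensional_tangentSpace (x : M) : FiniteDimensional ℝ (TangentSpace I x) :=
  inferInstanceAs (FiniteDimensional ℝ E)

variable [IsManifold I ∞ M] [RiemannianBundle (fun x : M ↦ TangentSpace I x)]
  [IsContMDiffRiemannianBundle I ∞ E (fun x : M ↦ TangentSpace I x)]

/-- The right-hand side of the Koszul formula for `2 g(∇_X Y, Z)` at the point `x`. -/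
def koszul (X Y Z : Π x : M, TangentSpace I x) (x : M) : ℝ :=
  mvfderiv I (fun y ↦ inner ℝ (Y y) (Z y)) x (X x)
    + mvfderiv I (fun y ↦ inner ℝ (X y) (Z y)) x (Y x)
    - mvfderiv I (fun y ↦ inner ℝ (X y) (Y y)) x (Z x)
    + inner ℝ (mlieBracket I X Y x) (Z x)
    - inner ℝ (mlieBracket I X Z x) (Y x)
    - inner ℝ (mlieBracket I Y Z x) (X x)

theorem koszul_tensorial_left {Y Z : Π x : M, TangentSpace I x} {x : M}
    (hY : MDiffAt (T% Y) x) (hZ : MDiffAt (T% Z) x) :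
    TensorialAt I E (fun X : Π x : M, TangentSpace I x ↦ koszul X Y Z x) x where
  smul {f X} hf hX := by
    simp only [koszul, Pi.smul_apply', inner_smul_left, RCLike.conj_to_real,
      mlieBracket_smul_left hf hX]
    rw [mvfderiv_fun_mul hf (mdiffAt_inner hX hZ), mvfderiv_fun_mul hf (mdiffAt_inner hX hY)]
    simp [inner_add_left, inner_smul_left, inner_smul_right]
    ring
  add {X X'} hX hX' := by
    simp only [koszul, Pi.add_apply, inner_add_left, mlieBracket_add_left hX hX']
    rw [mvfderiv_fun_add (mdiffAt_inner hX hZ) (mdiffAt_inner hX' hZ),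
      mvfderiv_fun_add (mdiffAt_inner hX hY) (mdiffAt_inner hX' hY)]
    simp [inner_add_right]
    ring

theorem koszul_tensorial_right {X Y : Π x : M, TangentSpace I x} {x : M}
    (hX : MDiffAt (T% X) x) (hY : MDiffAt (T% Y) x) :
    TensorialAt I E (fun Z : Π x : M, TangentSpace I x ↦ koszul X Y Z x) x where
  smul {f Z} hf hZ := by
    simp only [koszul, Pi.smul_apply', inner_smul_right,
      mlieBracket_smul_right hf hZ]
    rw [mvfderiv_fun_mul hf (mdiffAt_inner hX hZ), mvfderiv_fun_mul hf (mdiffAt_inner hY hZ)]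
    simp [inner_add_left, inner_smul_left]
    rw [real_inner_comm (X x) (Z x), real_inner_comm (Y x) (Z x)]
    ring
  add {Z Z'} hZ hZ' := by
    simp only [koszul, Pi.add_apply, inner_add_right, mlieBracket_add_right hZ hZ']
    rw [mvfderiv_fun_add (mdiffAt_inner hX hZ) (mdiffAt_inner hX hZ'),
      mvfderiv_fun_add (mdiffAt_inner hY hZ) (mdiffAt_inner hY hZ')]
    simp [inner_add_left]
    ring

theorem koszul_add_mid {X Y Y' Z : Π x : M, TangentSpace I x} {x : M}
    (hX : MDiffAt (T% X) x) (hY : MDiffAt (T% Y) x) (hY' : MDiffAt (T% Y') x)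
    (hZ : MDiffAt (T% Z) x) :
    koszul X (Y + Y') Z x = koszul X Y Z x + koszul X Y' Z x := by
  simp only [koszul, Pi.add_apply, inner_add_left, inner_add_right, mlieBracket_add_left hY hY',
    mlieBracket_add_right hY hY']
  rw [mvfderiv_fun_add (mdiffAt_inner hX hY) (mdiffAt_inner hX hY'),
    mvfderiv_fun_add (mdiffAt_inner hY hZ) (mdiffAt_inner hY' hZ)]
  simp
  ring

theorem koszul_smul_mid {X Y Z : Π x : M, TangentSpace I x} {f : M → ℝ} {x : M}
    (hX : MDiffAt (T% X) x) (hY : MDiffAt (T% Y) x) (hf : MDiffAt f x)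
    (hZ : MDiffAt (T% Z) x) :
    koszul X (f • Y) Z x =
      f x * koszul X Y Z x + 2 * (mvfderiv I f x (X x) * inner ℝ (Y x) (Z x)) := by
  simp only [koszul, Pi.smul_apply', inner_smul_left, inner_smul_right, RCLike.conj_to_real,
      mlieBracket_smul_left hf hY, mlieBracket_smul_right hf hY]
  rw [mvfderiv_fun_mul hf (mdiffAt_inner hY hZ), mvfderiv_fun_mul hf (mdiffAt_inner hX hY)]
  simp [inner_add_left, inner_smul_left]
  rw [real_inner_comm (X x) (Y x)]
  ring

open Classical in
/-- The bilinear form `(X, Z) ↦ 2 g(∇_X Y, Z)` on the tangent space at `x`, for a vector field `Y`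
that is differentiable at `x` (and zero otherwise). -/
def koszulForm (Y : Π x : M, TangentSpace I x) (x : M) :
    TangentSpace I x →L[ℝ] TangentSpace I x →L[ℝ] ℝ :=
  if hY : MDiffAt (T% Y) x then
    TensorialAt.mkHom₂ (fun X Z : Π x : M, TangentSpace I x ↦ koszul X Y Z x) x
      (fun _ hZ ↦ koszul_tensorial_left hY hZ) (fun _ hX ↦ koszul_tensorial_right hX hY)
  else 0

theorem koszulForm_apply {X Y Z : Π x : M, TangentSpace I x} {x : M}
    (hX : MDiffAt (T% X) x) (hY : MDiffAt (T% Y) x) (hZ : MDiffAt (T% Z) x) :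
    koszulForm Y x (X x) (Z x) = koszul X Y Z x := by
  rw [koszulForm, dif_pos hY]
  exact TensorialAt.mkHom₂_apply _ _ hX hZ

/-- `∇Y` at `x`, as the linear map `X ↦ ∇_X Y` determined by the Koszul formula. -/
def leviCivitaFun (Y : Π x : M, TangentSpace I x) (x : M) :
    TangentSpace I x →L[ℝ] TangentSpace I x :=
  (1 / 2 : ℝ) • InnerProductSpace.continuousLinearMapOfBilin (𝕜 := ℝ) (koszulForm Y x)

theorem two_mul_inner_leviCivitaFun {X Y Z : Π x : M, TangentSpace I x} {x : M}
    (hX : MDiffAt (T% X) x) (hY : MDiffAt (T% Y) x) (hZ : MDiffAt (T% Z) x) :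
    2 * inner ℝ (leviCivitaFun Y x (X x)) (Z x) = koszul X Y Z x := by
  rw [← koszulForm_apply hX hY hZ]
  have := InnerProductSpace.continuousLinearMapOfBilin_apply (𝕜 := ℝ) (koszulForm Y x) (X x) (Z x)
  rw [← this]
  simp [leviCivitaFun, inner_smul_left]

variable (I) in
/-- The Levi-Civita connection of the Riemannian manifold `M`, constructed from the Koszul formula.
`leviCivita I Y x (X x)` is the value of `∇_X Y` at `x`. -/
def leviCivita : CovariantDerivative I E (TangentSpace I : M → Type _) where
  toFun := leviCivitaFun
  isCovariantDerivativeOnUniv :=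
    { add := by
        intro Y Y' x hY hY' _
        ext1 u
        refine ext_inner_right ℝ fun w ↦ ?_
        have hu := FiberBundle.mdifferentiableAt_extend I E u
        have hw := FiberBundle.mdifferentiableAt_extend I E w
        have hYY' := mdifferentiableAt_add_section hY hY'
        have h1 := two_mul_inner_leviCivitaFun hu hYY' hw
        have h2 := two_mul_inner_leviCivitaFun hu hY hw
        have h3 := two_mul_inner_leviCivitaFun hu hY' hw
        have h4 := koszul_add_mid hu hY hY' hw
        simp only [FiberBundle.extend_apply_self] at h1 h2 h3
        rw [add_apply, inner_add_left]
        linarith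
      leibniz := by
        intro Y f x hY hf _
        ext1 u
        refine ext_inner_right ℝ fun w ↦ ?_
        have hu := FiberBundle.mdifferentiableAt_extend I E u
        have hw := FiberBundle.mdifferentiableAt_extend I E w
        have hfY := hf.smul_section hY
        have h1 := two_mul_inner_leviCivitaFun hu hfY hw
        have h2 := two_mul_inner_leviCivitaFun hu hY hw
        have h4 := koszul_smul_mid hu hY hf hw
        simp only [FiberBundle.extend_apply_self] at h1 h2 h4
        rw [add_apply, inner_add_left]
        simp only [smul_apply, ContinuousLinearMap.smulRight_apply,
          inner_smul_left, RCLike.conj_to_real]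
        rw [← h1, ← h2] at h4
        linarith }

theorem two_mul_inner_leviCivita {X Y Z : Π x : M, TangentSpace I x} {x : M}
    (hX : MDiffAt (T% X) x) (hY : MDiffAt (T% Y) x) (hZ : MDiffAt (T% Z) x) :
    2 * inner ℝ (leviCivita I Y x (X x)) (Z x) = koszul X Y Z x :=
  two_mul_inner_leviCivitaFun hX hY hZ

/-- The Levi-Civita connection is compatible with the metric. -/
theorem leviCivita_metric {X Y Z : Π x : M, TangentSpace I x} {x : M}
    (hX : MDiffAt (T% X) x) (hY : MDiffAt (T% Y) x) (hZ : MDiffAt (T% Z) x) :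
    mvfderiv I (fun y ↦ inner ℝ (Y y) (Z y)) x (X x) =
      inner ℝ (leviCivita I Y x (X x)) (Z x) + inner ℝ (Y x) (leviCivita I Z x (X x)) := by
  have h1 := two_mul_inner_leviCivita hX hY hZ
  have h2 := two_mul_inner_leviCivita hX hZ hY
  have h3 : (fun y ↦ inner ℝ (Z y) (Y y)) = fun y ↦ inner ℝ (Y y) (Z y) :=
    funext fun y ↦ real_inner_comm _ _
  simp only [koszul, h3] at h1 h2
  rw [mlieBracket_swap_apply (V := Z) (W := Y), inner_neg_left] at h2
  rw [real_inner_comm _ (Y x)]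
  linarith

/-- The Levi-Civita connection is torsion-free. -/
theorem leviCivita_torsion {X Y : Π x : M, TangentSpace I x} {x : M}
    (hX : MDiffAt (T% X) x) (hY : MDiffAt (T% Y) x) :
    leviCivita I Y x (X x) - leviCivita I X x (Y x) = mlieBracket I X Y x := by
  refine ext_inner_right ℝ fun w ↦ ?_
  have hw := FiberBundle.mdifferentiableAt_extend I E w
  have h1 := two_mul_inner_leviCivita hX hY hw
  have h2 := two_mul_inner_leviCivita hY hX hw
  have h3 : (fun y ↦ inner ℝ (Y y) (X y)) = fun y ↦ inner ℝ (X y) (Y y) :=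
    funext fun y ↦ real_inner_comm _ _
  simp only [koszul, h3] at h1 h2
  rw [mlieBracket_swap_apply (V := Y) (W := X), inner_neg_left] at h2
  simp only [FiberBundle.extend_apply_self] at h1 h2
  rw [inner_sub_left]
  linarith

variable (I) in
/-- The vector field `∇_X Y`. -/
def nabla (X Y : Π x : M, TangentSpace I x) : Π x : M, TangentSpace I x :=
  fun x ↦ leviCivita I Y x (X x)

end LeviCivita

section Distributions

variable {E : Type*} [NormedAddCommGroup E] [NormedSpace ℝ E] [FiniteDimensional ℝ E]
  {H : Type*} [TopologicalSpace H] (I : ModelWithCorners ℝ E H)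
  {M : Type*} [TopologicalSpace M] [ChartedSpace H M] [IsManifold I ∞ M]

/-- `X` is a smooth vector field on the open set `U`. -/
def IsSmoothFieldOn (X : Π x : M, TangentSpace I x) (U : Set M) : Prop :=
  ContMDiffOn I I.tangent ∞ (fun x ↦ (⟨x, X x⟩ : TangentBundle I M)) U

/-- `X ∈ Γ(D)`: `X` is a smooth vector field on `M` with values in the distribution `D`. -/
structure IsSection (D : Π x : M, Submodule ℝ (TangentSpace I x))
    (X : Π x : M, TangentSpace I x) : Prop where
  smooth : IsSmoothFieldOn I X Set.univ
  mem : ∀ x, X x ∈ D x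

/-- `D` is a smooth distribution, that is, a smooth subbundle of the tangent bundle: around each
point it has a frame consisting of smooth vector fields. -/
def IsDistribution (D : Π x : M, Submodule ℝ (TangentSpace I x)) : Prop :=
  ∀ p : M, ∃ U : Set M, IsOpen U ∧ p ∈ U ∧ ∃ (k : ℕ) (X : Fin k → Π x : M, TangentSpace I x),
    (∀ i, IsSmoothFieldOn I (X i) U) ∧
    ∀ x ∈ U, LinearIndependent ℝ (fun i ↦ X i x) ∧
      Submodule.span ℝ (Set.range fun i ↦ X i x) = D x

variable [RiemannianBundle (fun x : M ↦ TangentSpace I x)]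
  [IsContMDiffRiemannianBundle I ∞ E (fun x : M ↦ TangentSpace I x)]

/-- The second fundamental form of the distribution `D` (along an integral manifold of `D`, it is
the second fundamental form of that submanifold): the component of `∇_X Y` normal to `D`. -/
def secondFundamentalForm (D : Π x : M, Submodule ℝ (TangentSpace I x))
    (X Y : Π x : M, TangentSpace I x) : Π x : M, TangentSpace I x :=
  fun x ↦ (D x)ᗮ.starProjection (nabla I X Y x)

/-- The distribution `D` defines a totally geodesic foliation: it is integrable (closed under the
Lie bracket), and its leaves are totally geodesic, that is, their second fundamental form
vanishes. -/
structure DefinesTotallyGeodesicFoliation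
    (D : Π x : M, Submodule ℝ (TangentSpace I x)) : Prop where
  integrable : ∀ X Y : Π x : M, TangentSpace I x, IsSection I D X → IsSection I D Y →
    ∀ x, mlieBracket I X Y x ∈ D x
  totallyGeodesic : ∀ X Y : Π x : M, TangentSpace I x, IsSection I D X → IsSection I D Y →
    ∀ x, secondFundamentalForm I D X Y x = 0

end Distributions

section Complex

variable {E : Type*} [NormedAddCommGroup E] [NormedSpace ℝ E] [FiniteDimensional ℝ E]
  {H : Type*} [TopologicalSpace H] (I : ModelWithCorners ℝ E H)
  {M : Type*} [TopologicalSpace M] [ChartedSpace H M] [IsManifold I ∞ M]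
  [RiemannianBundle (fun x : M ↦ TangentSpace I x)]

/-- `J` is a smooth almost complex structure on `M` that is orthogonal for the metric of `M`. -/
structure IsAlmostHermitian (J : Π x : M, TangentSpace I x →L[ℝ] TangentSpace I x) : Prop where
  smooth : ContMDiff I (I.prod 𝓘(ℝ, E →L[ℝ] E)) ∞
    (fun x ↦ TotalSpace.mk' (E →L[ℝ] E) (E := fun x : M ↦ TangentSpace I x →L[ℝ] TangentSpace I x)
      x (J x))
  sq : ∀ (x : M) (v : TangentSpace I x), J x (J x v) = -v
  inner_map : ∀ (x : M) (v w : TangentSpace I x), inner ℝ (J x v) (J x w) = inner ℝ v w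

/-- `(M, g, J)` is a Kähler manifold: it is almost Hermitian and `∇J = 0`, that is,
`∇_X (JY) = J ∇_X Y` for all smooth vector fields `X`, `Y`. -/
structure IsKahler [IsContMDiffRiemannianBundle I ∞ E (fun x : M ↦ TangentSpace I x)]
    (J : Π x : M, TangentSpace I x →L[ℝ] TangentSpace I x) : Prop
    extends IsAlmostHermitian I J where
  parallel : ∀ X Y : Π x : M, TangentSpace I x,
    IsSmoothFieldOn I X Set.univ → IsSmoothFieldOn I Y Set.univ →
    ∀ x, nabla I X (fun y ↦ J y (Y y)) x = J x (nabla I X Y x)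

end Complex

section Submersions

variable {E : Type*} [NormedAddCommGroup E] [NormedSpace ℝ E] [FiniteDimensional ℝ E]
  {H : Type*} [TopologicalSpace H] (I : ModelWithCorners ℝ E H)
  {M : Type*} [TopologicalSpace M] [ChartedSpace H M] [IsManifold I ∞ M]
  [RiemannianBundle (fun x : M ↦ TangentSpace I x)]
  {E' : Type*} [NormedAddCommGroup E'] [NormedSpace ℝ E'] [FiniteDimensional ℝ E']
  {H' : Type*} [TopologicalSpace H'] (I' : ModelWithCorners ℝ E' H')
  {N : Type*} [TopologicalSpace N] [ChartedSpace H' N] [IsManifold I' ∞ N]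

/-- The vertical distribution `ker F_*`. -/
def verticalSpace (F : M → N) (x : M) : Submodule ℝ (TangentSpace I x) :=
  LinearMap.ker (mfderiv I I' F x).toLinearMap

/-- The horizontal distribution `(ker F_*)ᗮ`. -/
def horizontalSpace (F : M → N) (x : M) : Submodule ℝ (TangentSpace I x) :=
  (verticalSpace I I' F x)ᗮ

/-- `F` is a Riemannian submersion from `M` onto `N`: a smooth surjective map with surjective
differentials that preserve the lengths of horizontal vectors. -/
structure IsRiemannianSubmersion [RiemannianBundle (fun y : N ↦ TangentSpace I' y)]
    (F : M → N) : Prop where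
  smooth : ContMDiff I I' ∞ F
  surjective : Function.Surjective F
  surjective_mfderiv : ∀ x, Function.Surjective (mfderiv I I' F x)
  norm_map : ∀ x, ∀ v ∈ horizontalSpace I I' F x, ‖mfderiv I I' F x v‖ = ‖v‖

variable {I} in
/-- The angle between a vector `v` and a subspace `W`: the angle between `v` and its orthogonal
projection to `W` (it is `π / 2` if `v` is orthogonal to `W`). -/
def angleWith {x : M} (v : TangentSpace I x) (W : Submodule ℝ (TangentSpace I x)) : ℝ :=
  InnerProductGeometry.angle v (W.starProjection v)

/-- `F` is a v-semi-slant submersion from the almost Hermitian manifold `(M, g, J)` onto `N`. Here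
`D₂`, the orthogonal complement of `D₁` in the horizontal distribution, is
`(D₁)ᗮ ⊓ horizontalSpace I I' F`. -/
structure IsVSemiSlantSubmersion [RiemannianBundle (fun y : N ↦ TangentSpace I' y)]
    (J : Π x : M, TangentSpace I x →L[ℝ] TangentSpace I x) (F : M → N) : Prop
    extends IsRiemannianSubmersion I I' F where
  exists_slant : ∃ D₁ : Π x : M, Submodule ℝ (TangentSpace I x),
    IsDistribution I D₁ ∧
    (∀ x, D₁ x ≤ horizontalSpace I I' F x) ∧
    (∀ x, (D₁ x).map (J x).toLinearMap = D₁ x) ∧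
    ∃ θ : ℝ, ∀ x, ∀ v ∈ (D₁ x)ᗮ ⊓ horizontalSpace I I' F x, v ≠ 0 →
      angleWith (J x v) ((D₁ x)ᗮ ⊓ horizontalSpace I I' F x) = θ

/-- `𝒱U`, the vertical part of the vector field `U`. -/
def vert (F : M → N) (U : Π x : M, TangentSpace I x) : Π x : M, TangentSpace I x :=
  fun x ↦ (verticalSpace I I' F x).starProjection (U x)

/-- `ℋU`, the horizontal part of the vector field `U`. -/
def hor (F : M → N) (U : Π x : M, TangentSpace I x) : Π x : M, TangentSpace I x :=
  fun x ↦ (horizontalSpace I I' F x).starProjection (U x)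

/-- `φX`, the vertical part of `JX`, for a vertical vector field `X`. -/
def phi (F : M → N) (J : Π x : M, TangentSpace I x →L[ℝ] TangentSpace I x)
    (X : Π x : M, TangentSpace I x) : Π x : M, TangentSpace I x :=
  vert I I' F (fun x ↦ J x (X x))

/-- `BZ`, the vertical part of `JZ`, for a horizontal vector field `Z`. -/
def bPart (F : M → N) (J : Π x : M, TangentSpace I x →L[ℝ] TangentSpace I x)
    (Z : Π x : M, TangentSpace I x) : Π x : M, TangentSpace I x :=
  vert I I' F (fun x ↦ J x (Z x))

/-- `CZ`, the horizontal part of `JZ`, for a horizontal vector field `Z`. -/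
def cPart (F : M → N) (J : Π x : M, TangentSpace I x →L[ℝ] TangentSpace I x)
    (Z : Π x : M, TangentSpace I x) : Π x : M, TangentSpace I x :=
  hor I I' F (fun x ↦ J x (Z x))

/-- O'Neill's tensor `𝒜_U W = ℋ∇_{ℋU}𝒱W + 𝒱∇_{ℋU}ℋW`. -/
def tensorA [IsContMDiffRiemannianBundle I ∞ E (fun x : M ↦ TangentSpace I x)]
    (F : M → N) (U W : Π x : M, TangentSpace I x) : Π x : M, TangentSpace I x :=
  hor I I' F (nabla I (hor I I' F U) (vert I I' F W))
    + vert I I' F (nabla I (hor I I' F U) (hor I I' F W))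

end Submersions

end SlantSubmersion
end

open InnerProductSpace

section Frames

variable {EB : Type*} [NormedAddCommGroup EB] [NormedSpace ℝ EB]
  {HB : Type*} [TopologicalSpace HB] {IB : ModelWithCorners ℝ EB HB} {n : ℕ∞ω}
  {B : Type*} [TopologicalSpace B] [ChartedSpace HB B]
  {F : Type*} [NormedAddCommGroup F] [NormedSpace ℝ F]
  {V : B → Type*} [TopologicalSpace (TotalSpace F V)] [∀ x, NormedAddCommGroup (V x)]
  [∀ x, InnerProductSpace ℝ (V x)] [FiberBundle F V] [VectorBundle ℝ F V]
  [IsContMDiffRiemannianBundle IB n F V]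

/-- The Gram-Schmidt process preserves smoothness of sections of a Riemannian bundle. -/
theorem contMDiffAt_gramSchmidt {ι : Type*} [LinearOrder ι] [LocallyFiniteOrderBot ι]
    [WellFoundedLT ι] {s : ι → Π x : B, V x} {x : B}
    (hs : ∀ i, CMDiffAt n (T% (s i)) x) (hli : LinearIndependent ℝ (s · x)) (i : ι) :
    CMDiffAt n (T% (fun y ↦ gramSchmidt ℝ (s · y) i)) x := by
  induction i using WellFoundedLT.induction with
  | ind i ih =>
    have key : T% (fun y ↦ gramSchmidt ℝ (s · y) i) = T% (s i - fun y ↦ ∑ j ∈ Finset.Iio i,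
        (inner ℝ (gramSchmidt ℝ (s · y) j) (s i y)
          / inner ℝ (gramSchmidt ℝ (s · y) j) (gramSchmidt ℝ (s · y) j))
            • gramSchmidt ℝ (s · y) j) := by
      funext y
      refine congrArg (TotalSpace.mk' F y) ?_
      rw [gramSchmidt_def]
      simp [Submodule.starProjection_singleton]
    rw [key]
    refine ContMDiffAt.sub_section (hs i) (ContMDiffAt.sum_section fun j hj ↦ ?_)
    have hj' := ih j (Finset.mem_Iio.1 hj)
    refine ContMDiffAt.smul_section (ContMDiffAt.div₀ (hj'.inner_bundle (hs i))
      (hj'.inner_bundle hj') ?_) hj'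
    exact inner_self_ne_zero.2 (gramSchmidt_ne_zero j hli)

/-- A vector of an inner product space is determined by its inner products with the
Gram-Schmidt orthogonalization of a basis. -/
theorem sum_inner_gramSchmidt_smul {ι W : Type*} [LinearOrder ι] [LocallyFiniteOrderBot ι]
    [WellFoundedLT ι] [Fintype ι] [NormedAddCommGroup W] [InnerProductSpace ℝ W]
    {s : ι → W} (hli : LinearIndependent ℝ s) (hsp : ⊤ ≤ Submodule.span ℝ (Set.range s)) (v : W) :
    v = ∑ i, (inner ℝ v (gramSchmidt ℝ s i)
      / inner ℝ (gramSchmidt ℝ s i) (gramSchmidt ℝ s i)) • gramSchmidt ℝ s i := by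
  have hv : v ∈ Submodule.span ℝ (Set.range (gramSchmidt ℝ s)) := by
    rw [span_gramSchmidt]
    exact hsp trivial
  obtain ⟨c, rfl⟩ := (Submodule.mem_span_range_iff_exists_fun ℝ).1 hv
  refine Finset.sum_congr rfl fun i _ ↦ ?_
  rw [sum_inner, Finset.sum_eq_single i]
  · rw [real_inner_smul_left, mul_div_cancel_right₀ _
      (inner_self_ne_zero.2 (gramSchmidt_ne_zero i hli))]
  · intro j _ hj
    rw [real_inner_smul_left, gramSchmidt_orthogonal ℝ s hj, mul_zero]
  · simp

/-- A section of a Riemannian bundle is smooth at a point if its inner products with all sections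
that are smooth at this point are. -/
theorem contMDiffAt_section_of_inner [FiniteDimensional ℝ F] [ContMDiffVectorBundle n F V IB]
    {v : Π x : B, V x} {x : B}
    (h : ∀ w : Π x : B, V x, CMDiffAt n (T% w) x → CMDiffAt n (fun y ↦ inner ℝ (v y) (w y)) x) :
    CMDiffAt n (T% v) x := by
  let e := trivializationAt F V x
  have hx : x ∈ e.baseSet := FiberBundle.mem_baseSet_trivializationAt' x
  have hs := e.isLocalFrameOn_localFrame_baseSet IB n (Module.finBasis ℝ F)
  have hg := contMDiffAt_gramSchmidt (hs.contMDiffAt e.open_baseSet hx) (hs.linearIndependent hx)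
  have hsum : CMDiffAt n (T% (fun y ↦ ∑ i,
      (inner ℝ (v y) (gramSchmidt ℝ (e.localFrame (Module.finBasis ℝ F) · y) i)
        / inner ℝ (gramSchmidt ℝ (e.localFrame (Module.finBasis ℝ F) · y) i)
            (gramSchmidt ℝ (e.localFrame (Module.finBasis ℝ F) · y) i))
          • gramSchmidt ℝ (e.localFrame (Module.finBasis ℝ F) · y) i)) x := by
    refine ContMDiffAt.sum_section fun i _ ↦ ContMDiffAt.smul_section
      (ContMDiffAt.div₀ (h _ (hg i)) ((hg i).inner_bundle (hg i)) ?_) (hg i)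
    exact inner_self_ne_zero.2 (gramSchmidt_ne_zero i (hs.linearIndependent hx))
  refine hsum.congr_of_eventuallyEq ?_
  filter_upwards [e.open_baseSet.mem_nhds hx] with y hy
  exact congrArg (TotalSpace.mk' F y)
    (sum_inner_gramSchmidt_smul (hs.linearIndependent hy) (hs.generating hy) (v y))

end Frames

namespace SlantSubmersion

section Connection

variable {E : Type*} [NormedAddCommGroup E] [NormedSpace ℝ E] [FiniteDimensional ℝ E]
  {H : Type*} [TopologicalSpace H] {I : ModelWithCorners ℝ E H}
  {M : Type*} [TopologicalSpace M] [ChartedSpace H M] [IsManifold I ∞ M]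
  [RiemannianBundle (fun x : M ↦ TangentSpace I x)]
  [IsContMDiffRiemannianBundle I ∞ E (fun x : M ↦ TangentSpace I x)]

theorem nabla_zero_right (X : Π x : M, TangentSpace I x) : nabla I X 0 = 0 := by
  ext1 x
  simp [nabla]

theorem nabla_add_right {X Y Z : Π x : M, TangentSpace I x}
    (hY : ∀ x, MDiffAt (T% Y) x) (hZ : ∀ x, MDiffAt (T% Z) x) :
    nabla I X (Y + Z) = nabla I X Y + nabla I X Z := by
  ext1 x
  simp [nabla, (leviCivita I).isCovariantDerivativeOnUniv.add (hY x) (hZ x)]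

end Connection

section Isometry

variable {E : Type*} [NormedAddCommGroup E] [NormedSpace ℝ E]
  {H : Type*} [TopologicalSpace H] {I : ModelWithCorners ℝ E H}
  {M : Type*} [TopologicalSpace M] [ChartedSpace H M]
  [RiemannianBundle (fun x : M ↦ TangentSpace I x)]
  {E' : Type*} [NormedAddCommGroup E'] [NormedSpace ℝ E']
  {H' : Type*} [TopologicalSpace H'] {I' : ModelWithCorners ℝ E' H'}
  {N : Type*} [TopologicalSpace N] [ChartedSpace H' N]
  [RiemannianBundle (fun y : N ↦ TangentSpace I' y)] {F : M → N}

theorem IsRiemannianSubmersion.inner_map (hF : IsRiemannianSubmersion I I' F) {x : M}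
    {v w : TangentSpace I x} (hv : v ∈ horizontalSpace I I' F x)
    (hw : w ∈ horizontalSpace I I' F x) :
    inner ℝ (mfderiv I I' F x v) (mfderiv I I' F x w) = inner ℝ v w := by
  rw [real_inner_eq_norm_add_mul_self_sub_norm_mul_self_sub_norm_mul_self_div_two,
    real_inner_eq_norm_add_mul_self_sub_norm_mul_self_sub_norm_mul_self_div_two, ← map_add,
    hF.norm_map x v hv, hF.norm_map x w hw, hF.norm_map x _ (add_mem hv hw)]

end Isometry

section Submersions

variable {E : Type*} [NormedAddCommGroup E] [NormedSpace ℝ E] [FiniteDimensional ℝ E]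
  {H : Type*} [TopologicalSpace H] {I : ModelWithCorners ℝ E H}
  {M : Type*} [TopologicalSpace M] [ChartedSpace H M]
  [RiemannianBundle (fun x : M ↦ TangentSpace I x)]
  {E' : Type*} [NormedAddCommGroup E'] [NormedSpace ℝ E']
  {H' : Type*} [TopologicalSpace H'] {I' : ModelWithCorners ℝ E' H'}
  {N : Type*} [TopologicalSpace N] [ChartedSpace H' N]
  {F : M → N}

theorem orthogonal_horizontalSpace (x : M) :
    (horizontalSpace I I' F x)ᗮ = verticalSpace I I' F x :=
  Submodule.orthogonal_orthogonal _

theorem vert_apply (U : Π x : M, TangentSpace I x) (x : M) :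
    vert I I' F U x = (verticalSpace I I' F x).starProjection (U x) := rfl

theorem hor_apply (U : Π x : M, TangentSpace I x) (x : M) :
    hor I I' F U x = (horizontalSpace I I' F x).starProjection (U x) := rfl

theorem vert_add_hor (U : Π x : M, TangentSpace I x) : vert I I' F U + hor I I' F U = U :=
  funext fun x ↦ Submodule.starProjection_add_starProjection_orthogonal
    (K := verticalSpace I I' F x) (U x)

theorem vert_add (U W : Π x : M, TangentSpace I x) :
    vert I I' F (U + W) = vert I I' F U + vert I I' F W :=
  funext fun _ ↦ map_add _ _ _

theorem hor_add (U W : Π x : M, TangentSpace I x) :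
    hor I I' F (U + W) = hor I I' F U + hor I I' F W :=
  funext fun _ ↦ map_add _ _ _

theorem vert_vert (U : Π x : M, TangentSpace I x) :
    vert I I' F (vert I I' F U) = vert I I' F U :=
  funext fun _ ↦ Submodule.starProjection_eq_self_iff.2 (Submodule.starProjection_apply_mem _ _)

theorem hor_hor (U : Π x : M, TangentSpace I x) :
    hor I I' F (hor I I' F U) = hor I I' F U :=
  funext fun _ ↦ Submodule.starProjection_eq_self_iff.2 (Submodule.starProjection_apply_mem _ _)

theorem vert_hor (U : Π x : M, TangentSpace I x) : vert I I' F (hor I I' F U) = 0 := by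
  have h := vert_add (I' := I') (F := F) (vert I I' F U) (hor I I' F U)
  rwa [vert_add_hor, vert_vert, left_eq_add] at h

theorem hor_vert (U : Π x : M, TangentSpace I x) : hor I I' F (vert I I' F U) = 0 := by
  have h := vert_add_hor (I' := I') (F := F) (vert I I' F U)
  rwa [vert_vert, add_eq_left] at h

theorem hor_eq_self {U : Π x : M, TangentSpace I x}
    (hU : ∀ x, U x ∈ horizontalSpace I I' F x) : hor I I' F U = U :=
  funext fun x ↦ Submodule.starProjection_eq_self_iff.2 (hU x)

theorem mem_horizontalSpace_iff_vert {U : Π x : M, TangentSpace I x} {x : M} :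
    U x ∈ horizontalSpace I I' F x ↔ vert I I' F U x = 0 :=
  (Submodule.starProjection_apply_eq_zero_iff (verticalSpace I I' F x)).symm

theorem mfderiv_hor (U : Π x : M, TangentSpace I x) (x : M) :
    mfderiv I I' F x (hor I I' F U x) = mfderiv I I' F x (U x) := by
  have hv : mfderiv I I' F x (vert I I' F U x) = 0 :=
    Submodule.starProjection_apply_mem (verticalSpace I I' F x) (U x)
  conv_rhs => rw [← vert_add_hor (I' := I') (F := F) U, Pi.add_apply, map_add, hv, zero_add]

theorem phi_vert_add_bPart_hor (J : Π x : M, TangentSpace I x →L[ℝ] TangentSpace I x)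
    (Z : Π x : M, TangentSpace I x) :
    phi I I' F J (vert I I' F Z) + bPart I I' F J (hor I I' F Z)
      = vert I I' F fun x ↦ J x (Z x) := by
  rw [phi, bPart, ← vert_add]
  congr 1
  ext1 x
  rw [Pi.add_apply, ← map_add, ← Pi.add_apply (vert I I' F Z), vert_add_hor]

section

variable [IsManifold I ∞ M] [IsContMDiffRiemannianBundle I ∞ E (fun x : M ↦ TangentSpace I x)]

/-- The horizontal distribution defines a totally geodesic foliation if and only if `𝒱∇_X Y = 0`
for all horizontal vector fields `X` and `Y`. -/
theorem definesTotallyGeodesicFoliation_horizontalSpace_iff :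
    DefinesTotallyGeodesicFoliation I (horizontalSpace I I' F) ↔
      ∀ X Y : Π x : M, TangentSpace I x, IsSection I (horizontalSpace I I' F) X →
        IsSection I (horizontalSpace I I' F) Y → vert I I' F (nabla I X Y) = 0 := by
  have hII (X Y : Π x : M, TangentSpace I x) (x : M) :
      secondFundamentalForm I (horizontalSpace I I' F) X Y x = vert I I' F (nabla I X Y) x := by
    simp only [secondFundamentalForm, orthogonal_horizontalSpace, vert_apply]
  refine ⟨fun h X Y hX hY ↦ funext fun x ↦ ?_, fun h ↦ ⟨fun X Y hX hY x ↦ ?_,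
    fun X Y hX hY x ↦ ?_⟩⟩
  · rw [← hII, h.totallyGeodesic X Y hX hY x, Pi.zero_apply]
  · have hd {Z : Π x : M, TangentSpace I x} (hZ : IsSection I (horizontalSpace I I' F) Z) :
        MDiffAt (T% Z) x :=
      (contMDiffOn_univ.1 hZ.smooth x).mdifferentiableAt (by simp)
    rw [← leviCivita_torsion (hd hX) (hd hY)]
    exact sub_mem (mem_horizontalSpace_iff_vert.2 (congrFun (h X Y hX hY) x))
      (mem_horizontalSpace_iff_vert.2 (congrFun (h Y X hY hX) x))
  · rw [hII, h X Y hX hY, Pi.zero_apply]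

end

variable [RiemannianBundle (fun y : N ↦ TangentSpace I' y)]

theorem IsRiemannianSubmersion.inner_hor (hF : IsRiemannianSubmersion I I' F)
    (U W : Π x : M, TangentSpace I x) (x : M) :
    inner ℝ (hor I I' F U x) (W x)
      = inner ℝ (mfderiv I I' F x (U x)) (mfderiv I I' F x (W x)) := by
  have hmem (Z : Π x : M, TangentSpace I x) : hor I I' F Z x ∈ horizontalSpace I I' F x :=
    Submodule.starProjection_apply_mem _ _
  rw [← mfderiv_hor U, ← mfderiv_hor W, hF.inner_map (hmem U) (hmem W)]
  have hVW : inner ℝ (hor I I' F U x) (vert I I' F W x) = 0 :=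
    Submodule.inner_left_of_mem_orthogonal (K := verticalSpace I I' F x)
      (Submodule.starProjection_apply_mem _ _) (hmem U)
  conv_lhs => rw [← vert_add_hor (I' := I') (F := F) W, Pi.add_apply, inner_add_right, hVW,
    zero_add]

variable [IsManifold I ∞ M] [IsManifold I' ∞ N]
  [IsContMDiffRiemannianBundle I ∞ E (fun x : M ↦ TangentSpace I x)]
  [IsContMDiffRiemannianBundle I' ∞ E' (fun y : N ↦ TangentSpace I' y)]

/-- The horizontal part of a smooth vector field is smooth. -/
theorem IsRiemannianSubmersion.contMDiffAt_hor (hF : IsRiemannianSubmersion I I' F)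
    {U : Π x : M, TangentSpace I x} {x : M} (hU : CMDiffAt ∞ (T% U) x) :
    CMDiffAt ∞ (T% (hor I I' F U)) x := by
  refine contMDiffAt_section_of_inner (V := fun x : M ↦ TangentSpace I x) fun W hW ↦ ?_
  have hdF := hF.smooth.contMDiff_tangentMap (m := ∞) le_rfl
  have hFU := (hdF _).comp x hU
  have hFW := (hdF _).comp x hW
  have := ContMDiffAt.inner_bundle (E := fun y : N ↦ TangentSpace I' y) (b := F)
    (v := fun y ↦ mfderiv I I' F y (U y)) (w := fun y ↦ mfderiv I I' F y (W y)) hFU hFW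
  exact this.congr_of_eventuallyEq (.of_forall fun y ↦ hF.inner_hor U W y)

theorem IsRiemannianSubmersion.contMDiffAt_vert (hF : IsRiemannianSubmersion I I' F)
    {U : Π x : M, TangentSpace I x} {x : M} (hU : CMDiffAt ∞ (T% U) x) :
    CMDiffAt ∞ (T% (vert I I' F U)) x := by
  have h : vert I I' F U = U - hor I I' F U :=
    eq_sub_of_add_eq (vert_add_hor (I' := I') (F := F) U)
  rw [h]
  exact hU.sub_section (hF.contMDiffAt_hor hU)

/-- The vector field in the criterion for the horizontal distribution to define a totally geodesic
foliation is `-𝒱∇_X Y`. -/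
theorem phi_add_bPart_eq_neg_vert_nabla {J : Π x : M, TangentSpace I x →L[ℝ] TangentSpace I x}
    (hJ : IsKahler I J) (hF : IsRiemannianSubmersion I I' F) {X Y : Π x : M, TangentSpace I x}
    (hX : IsSection I (horizontalSpace I I' F) X)
    (hY : IsSmoothFieldOn I Y Set.univ) :
    phi I I' F J (vert I I' F (nabla I X (bPart I I' F J Y))
          + tensorA I I' F X (cPart I I' F J Y))
        + bPart I I' F J (tensorA I I' F X (bPart I I' F J Y)
          + hor I I' F (nabla I X (cPart I I' F J Y)))
      = -vert I I' F (nabla I X Y) := by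
  have hJY (x : M) : CMDiffAt ∞ (T% (fun y ↦ J y (Y y))) x :=
    ContMDiffAt.clm_bundle_apply (E₁ := fun x : M ↦ TangentSpace I x)
      (E₂ := fun x : M ↦ TangentSpace I x) (b := fun x : M ↦ x) (hJ.smooth x)
      (contMDiffOn_univ.1 hY x)
  have hB : vert I I' F (bPart I I' F J Y) = bPart I I' F J Y := vert_vert _
  have hB' : hor I I' F (bPart I I' F J Y) = 0 := hor_vert _
  have hC : hor I I' F (cPart I I' F J Y) = cPart I I' F J Y := hor_hor _
  have hC' : vert I I' F (cPart I I' F J Y) = 0 := vert_hor _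
  have hsum : nabla I X (bPart I I' F J Y) + nabla I X (cPart I I' F J Y)
      = fun x ↦ J x (nabla I X Y x) := by
    have hsplit : bPart I I' F J Y + cPart I I' F J Y = fun x ↦ J x (Y x) := vert_add_hor _
    rw [← nabla_add_right (Y := bPart I I' F J Y) (Z := cPart I I' F J Y)
      (fun x ↦ (hF.contMDiffAt_vert (hJY x)).mdifferentiableAt (by simp))
      (fun x ↦ (hF.contMDiffAt_hor (hJY x)).mdifferentiableAt (by simp)), hsplit]
    exact funext (hJ.parallel X Y hX.smooth hY)
  have hzero : hor I I' F (0 : Π x : M, TangentSpace I x) = 0 := funext fun _ ↦ map_zero _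
  have hzero' : vert I I' F (0 : Π x : M, TangentSpace I x) = 0 := funext fun _ ↦ map_zero _
  simp only [tensorA, hor_eq_self hX.mem, hB, hB', hC, hC', nabla_zero_right, hzero, hzero',
    zero_add, add_zero]
  rw [← vert_add, ← hor_add, hsum, phi_vert_add_bPart_hor]
  ext1 x
  rw [vert_apply, hJ.sq, map_neg, Pi.neg_apply, vert_apply]

end Submersions

end SlantSubmersion

theorem proposition3p12
    {E : Type*} [NormedAddCommGroup E] [NormedSpace ℝ E] [FiniteDimensional ℝ E]
    {H : Type*} [TopologicalSpace H] (I : ModelWithCorners ℝ E H)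
    {M : Type*} [TopologicalSpace M] [ChartedSpace H M] [IsManifold I ∞ M]
    [T2Space M] [SecondCountableTopology M] [BoundarylessManifold I M]
    [RiemannianBundle (fun x : M ↦ TangentSpace I x)]
    [IsContMDiffRiemannianBundle I ∞ E (fun x : M ↦ TangentSpace I x)]
    {E' : Type*} [NormedAddCommGroup E'] [NormedSpace ℝ E'] [FiniteDimensional ℝ E']
    {H' : Type*} [TopologicalSpace H'] (I' : ModelWithCorners ℝ E' H')
    {N : Type*} [TopologicalSpace N] [ChartedSpace H' N] [IsManifold I' ∞ N]
    [T2Space N] [SecondCountableTopology N] [BoundarylessManifold I' N]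
    [RiemannianBundle (fun y : N ↦ TangentSpace I' y)]
    [IsContMDiffRiemannianBundle I' ∞ E' (fun y : N ↦ TangentSpace I' y)]
    (J : Π x : M, TangentSpace I x →L[ℝ] TangentSpace I x)
    (hJ : SlantSubmersion.IsKahler I J)
    (F : M → N) (hF : SlantSubmersion.IsVSemiSlantSubmersion I I' J F) :
    SlantSubmersion.DefinesTotallyGeodesicFoliation I (SlantSubmersion.horizontalSpace I I' F) ↔
      ∀ X Y : Π x : M, TangentSpace I x,
        SlantSubmersion.IsSection I (SlantSubmersion.horizontalSpace I I' F) X →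
        SlantSubmersion.IsSection I (SlantSubmersion.horizontalSpace I I' F) Y →
        SlantSubmersion.phi I I' F J
            (SlantSubmersion.vert I I' F
                (SlantSubmersion.nabla I X (SlantSubmersion.bPart I I' F J Y))
              + SlantSubmersion.tensorA I I' F X (SlantSubmersion.cPart I I' F J Y))
          + SlantSubmersion.bPart I I' F J
            (SlantSubmersion.tensorA I I' F X (SlantSubmersion.bPart I I' F J Y)
              + SlantSubmersion.hor I I' F
                (SlantSubmersion.nabla I X (SlantSubmersion.cPart I I' F J Y))) = 0 := by
  rw [SlantSubmersion.definesTotallyGeodesicFoliation_horizontalSpace_iff]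
  refine forall₄_congr fun X Y hX hY ↦ ?_
  rw [SlantSubmersion.phi_add_bPart_eq_neg_vert_nabla hJ hF.toIsRiemannianSubmersion hX hY.smooth,
    neg_eq_zero]
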